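/- Let $d\ge 1$ and let $\widehat{\mathbb C}=\mathbb C\cup\{\infty\}$ be the Riemann sphere. A polynomial $f(x,y)=\sum_{0\le i,j\le d}A_{(i,j)}x^iy^j\in\mathbb C[x,y]$ is called a correspondence of degree $d$ if (1) for all but finitely many $x\in\mathbb C$ the polynomial $f(x,\cdot)$ has exactly $d$ complex roots counted with multiplicity, and for all but finitely many $y\in\mathbb C$ so has $f(\cdot,y)$; and (2) the biprojective completion $\Gamma_f\subset\widehat{\mathbb C}\times\widehat{\mathbb C}$ of $\{f=0\}$, i.e. the zero locus of the bihomogenization $F([\xi:x],[\zeta:y])=\sum_{i,j}A_{(i,j)}x^i\xi^{d-i}y^j\zeta^{d-j}$, has no irreducible component of the form $\{a\}\times\widehat{\mathbb C}$ or $\widehat{\mathbb C}\times\{a\}$ with $a\in\widehat{\mathbb C}$. For $x_1\in\widehat{\mathbb C}$ let $Y(x_1)$ be the multiset of the $d$ points $y\in\widehat{\mathbb C}$ with $(x_1,y)\in\Gamma_f$, each repeated according to its multiplicity as a zero of the binary form $F(x_1,\cdot)$ of degree $d$; for $y_1\in\widehat{\mathbb C}$ define the multiset $X(y_1)$ of $d$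 points of $\widehat{\mathbb C}$ analogously from $F(\cdot,y_1)$. A correspondence $f$ of degree $d$ is called a map of $d$-tuples if $X(y)=X(y')$ for all $x_1\in\widehat{\mathbb C}$ and all $y,y'\in Y(x_1)$, and $Y(x)=Y(x')$ for all $y_1\in\widehat{\mathbb C}$ and all $x,x'\in X(y_1)$. **Theorem.** Let $f_d\in\mathbb C[x,y]$ be a correspondence of degree $d\ge1$ that cannot be written as $f_d=[g_k]^{d/k}$ with $k\mid d$, $k\ne d$, and $g_k\in\mathbb C[x,y]$ a map of $k$-tuples. Then $f_d$ is a map of $d$-tuples if and only if the variables in the equation $f_d(x,y)=0$ can be separated, i.e. the equation can be rewritten as $\Phi(x)=\Psi(y)$ with rational functions $\Phi,\Psi$ over $\mathbb C$ of degree $d$: there are $\Phi=P/Q$ and $\Psi=R/S$ with $P,Q$ coprime polynomials, $R,S$ coprime polynomials, $\max(\deg P,\deg Q)=\max(\deg R,\deg S)=d$, and a constant $c\in\mathbb C\setminus\{0\}$, such that $$f_d(x,y)=c\,\bigl(P(x)S(y)-Q(x)R(y)\bigr).$$ -/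

import Mathlib

noncomputable section

namespace PolyCorr

open Polynomial

/-- The coefficient `A_(i,j)` of `x ^ i * y ^ j` in `f ∈ ℂ[x, y]`. A bivariate polynomial is an
element of `ℂ[x][y]`: the inner variable is `x`, the outer variable is `y`. -/
def coeffXY (f : Polynomial (Polynomial ℂ)) (i j : ℕ) : ℂ := (f.coeff j).coeff i

/-- Homogeneous coordinates on the Riemann sphere: the point `z ∈ ℂ` is `[1 : z]` and the point
`∞` is `[0 : 1]`. -/
def hcoords : OnePoint ℂ → ℂ × ℂ
  | none => (0, 1)
  | some z => (1, z)

/-- The bihomogenization of bidegree `(d, d)`,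
`F([ξ : x], [ζ : y]) = ∑ A_(i,j) x ^ i ξ ^ (d - i) y ^ j ζ ^ (d - j)`,
evaluated at `p = (ξ, x)`, `q = (ζ, y)`. -/
def biform (d : ℕ) (f : Polynomial (Polynomial ℂ)) (p q : ℂ × ℂ) : ℂ :=
  ∑ i ∈ Finset.range (d + 1), ∑ j ∈ Finset.range (d + 1),
    coeffXY f i j * (p.2 ^ i * p.1 ^ (d - i)) * (q.2 ^ j * q.1 ^ (d - j))

/-- The biprojective completion of `{f = 0}` in the product of two Riemann spheres. -/
def graph (d : ℕ) (f : Polynomial (Polynomial ℂ)) : Set (OnePoint ℂ × OnePoint ℂ) :=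
  {p | biform d f (hcoords p.1) (hcoords p.2) = 0}

/-- The binary form `F(p, [ζ : y])` of degree `d`, dehomogenized at `ζ = 1`. -/
def sliceY (d : ℕ) (f : Polynomial (Polynomial ℂ)) (p : ℂ × ℂ) : Polynomial ℂ :=
  ∑ j ∈ Finset.range (d + 1),
    C (∑ i ∈ Finset.range (d + 1), coeffXY f i j * (p.2 ^ i * p.1 ^ (d - i))) * X ^ j

/-- The binary form `F([ξ : x], q)` of degree `d`, dehomogenized at `ξ = 1`. -/
def sliceX (d : ℕ) (f : Polynomial (Polynomial ℂ)) (q : ℂ × ℂ) : Polynomial ℂ :=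
  ∑ i ∈ Finset.range (d + 1),
    C (∑ j ∈ Finset.range (d + 1), coeffXY f i j * (q.2 ^ j * q.1 ^ (d - j))) * X ^ i

/-- The zeros on the Riemann sphere, with multiplicity, of the nonzero binary form of degree `d`
whose dehomogenization is `p` (so `p` has degree at most `d`): the roots of `p`, together with
the point `∞` with multiplicity `d - deg p`. -/
def sphereRoots (d : ℕ) (p : Polynomial ℂ) : Multiset (OnePoint ℂ) :=
  p.roots.map (fun z : ℂ => (z : OnePoint ℂ)) + Multiset.replicate (d - p.natDegree) OnePoint.infty

/-- The points of `Π_y (Π_x⁻¹ {x} ∩ Γ_f)`, repeated according to intersection multiplicity. -/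
def fiberY (d : ℕ) (f : Polynomial (Polynomial ℂ)) (x : OnePoint ℂ) : Multiset (OnePoint ℂ) :=
  sphereRoots d (sliceY d f (hcoords x))

/-- The points of `Π_x (Π_y⁻¹ {y} ∩ Γ_f)`, repeated according to intersection multiplicity. -/
def fiberX (d : ℕ) (f : Polynomial (Polynomial ℂ)) (y : OnePoint ℂ) : Multiset (OnePoint ℂ) :=
  sphereRoots d (sliceX d f (hcoords y))

/-- `f` is a polynomial correspondence of degree `d`: `f(x, ·)` and `f(·, y)` are generically
`d`-valued (counting multiplicity), and the biprojective completion of `{f = 0}` contains no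
vertical or horizontal line. (Such lines are irreducible curves, so one that is contained in the
curve is the same as one that is an irreducible component of it.) -/
structure IsCorrespondence (d : ℕ) (f : Polynomial (Polynomial ℂ)) : Prop where
  generic_x : {x : ℂ | Multiset.card (f.map (evalRingHom x)).roots ≠ d}.Finite
  generic_y : {y : ℂ | Multiset.card (f.eval (C y)).roots ≠ d}.Finite
  no_vertical : ∀ a : OnePoint ℂ, ¬ ({a} : Set (OnePoint ℂ)) ×ˢ Set.univ ⊆ graph d f
  no_horizontal : ∀ a : OnePoint ℂ, ¬ Set.univ ×ˢ ({a} : Set (OnePoint ℂ)) ⊆ graph d f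

/-- `f` is a map of `d`-tuples: a correspondence of degree `d` such that for each `x₁` the `d`
fibres over the points `y_j(x₁)` coincide as lists with multiplicity, and likewise with the roles
of `x` and `y` exchanged. -/
structure IsMapOfTuples (d : ℕ) (f : Polynomial (Polynomial ℂ)) : Prop where
  corr : IsCorrespondence d f
  coincide_x : ∀ x₁ : OnePoint ℂ, ∀ y ∈ fiberY d f x₁, ∀ y' ∈ fiberY d f x₁,
    fiberX d f y = fiberX d f y'
  coincide_y : ∀ y₁ : OnePoint ℂ, ∀ x ∈ fiberX d f y₁, ∀ x' ∈ fiberX d f y₁,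
    fiberY d f x = fiberY d f x'

/-- The degree of a rational function in lowest terms, i.e. its degree as a self-map of the
Riemann sphere. -/
def ratDegree (Φ : RatFunc ℂ) : ℕ := max Φ.num.natDegree Φ.denom.natDegree

/-- The numerator `num Φ(x) * denom Ψ(y) - num Ψ(y) * denom Φ(x)` of `Φ(x) - Ψ(y)`. -/
def separatedPoly (Φ Ψ : RatFunc ℂ) : Polynomial (Polynomial ℂ) :=
  C Φ.num * Ψ.denom.map C - C Φ.denom * Ψ.num.map C

/-- The equation `f(x, y) = 0` can be rewritten as `Φ(x) = Ψ(y)` with rational functions of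
degree `d`: after clearing denominators, the second equation is the first one up to a nonzero
constant factor. -/
def IsSeparable (d : ℕ) (f : Polynomial (Polynomial ℂ)) : Prop :=
  ∃ Φ Ψ : RatFunc ℂ, ratDegree Φ = d ∧ ratDegree Ψ = d ∧
    ∃ c : ℂ, c ≠ 0 ∧ f = C (C c) * separatedPoly Φ Ψ

end PolyCorr

end

/-!
Let `f` be a map of `d`-tuples. The horizontal slices `f(·, y)` through the points `y` of one
fibre have the same roots, so they are proportional. Choose two linearly independent coefficients
`a`, `b` of `f`, viewed as a polynomial in `x` with coefficients in `ℂ[y]`. For `y₀` in the fibre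
over `x`, the polynomial `b(y₀) a - a(y₀) b` then vanishes on this whole fibre. If `f` is
squarefree, a generic vertical slice `f(x, ·)` has simple roots, hence is a multiple of that
polynomial. So generic vertical slices lie in the span of `a` and `b`, which forces
`f = P(x) S(y) - Q(x) R(y)` with `R = a` and `S = b`.

In general, all irreducible factors of `f` have the same multiplicity `m`: over a generic `x` each
factor of multiplicity `m` has a point `(x, y)` at which `x` is a root of `f(·, y)` of multiplicity
`m`, and these multiplicities agree within a fibre. Hence `f = g ^ m` with `g` squarefree.

Conversely, if `f = P(x) S(y) - Q(x) R(y)`, then `f(·, y)` is determined up to a constant factor by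
`[R(y) : S(y)]`, which equals `[P(x) : Q(x)]` for every `y` in the fibre over `x`.
-/

noncomputable section

namespace PolyCorr

open Polynomial Polynomial.Bivariate Filter

section Univariate

variable {K : Type*} [Field K]

theorem exists_eq_C_mul_of_associated {p q : K[X]} (h : Associated p q) :
    ∃ c : K, c ≠ 0 ∧ p = C c * q := by
  obtain ⟨u, rfl⟩ := h.symm
  obtain ⟨c, hc, hu⟩ := Polynomial.isUnit_iff.1 u.isUnit
  exact ⟨c, hc.ne_zero, by rw [hu, mul_comm]⟩

theorem dvd_of_separable_of_isRoot [IsAlgClosed K] {p q : K[X]} (hp : p.Separable)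
    (h : ∀ y, p.IsRoot y → q.IsRoot y) : p ∣ q := by
  rcases eq_or_ne q 0 with rfl | hq
  · exact dvd_zero p
  refine (IsAlgClosed.splits p).dvd_of_roots_le_roots hp.ne_zero ?_
  refine (Multiset.le_iff_subset (nodup_roots hp)).2 fun y hy => ?_
  exact (mem_roots hq).2 (h y (isRoot_of_mem_roots hy))

theorem rootMultiplicity_pow_mul {u v : K[X]} {a : K} (hu : u.IsRoot a)
    (hu' : ¬ (derivative u).IsRoot a) (hv : ¬ v.IsRoot a) (m : ℕ) :
    (u ^ m * v).rootMultiplicity a = m := by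
  classical
  have hu0 : u ≠ 0 := by rintro rfl; simp at hu'
  have hv0 : v ≠ 0 := by rintro rfl; simp at hv
  have hsimple : u.rootMultiplicity a = 1 := by
    have hpos := (rootMultiplicity_pos hu0).2 hu
    have hle := mt (one_lt_rootMultiplicity_iff_isRoot hu0).1 fun h => hu' h.2
    omega
  rw [rootMultiplicity_mul (mul_ne_zero (pow_ne_zero m hu0) hv0), rootMultiplicity_eq_zero hv,
    ← count_roots, roots_pow, Multiset.count_nsmul, count_roots, hsimple, mul_one, add_zero]

theorem exists_eq_C_mul_num_denom {P Q : K[X]} (hPQ : IsCoprime P Q) (hQ : Q ≠ 0) :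
    ∃ (Φ : RatFunc K) (e : K), e ≠ 0 ∧ P = C e * Φ.num ∧ Q = C e * Φ.denom := by
  let Φ : RatFunc K := algebraMap K[X] (RatFunc K) P / algebraMap K[X] (RatFunc K) Q
  have hcross : Φ.num * Q = P * Φ.denom := (RatFunc.num_mul_eq_mul_denom_iff hQ).2 rfl
  have hQΦ : Q ∣ Φ.denom := hPQ.symm.dvd_of_dvd_mul_left (hcross ▸ dvd_mul_left Q Φ.num)
  obtain ⟨e, he, hQe⟩ := exists_eq_C_mul_of_associated
    (associated_of_dvd_dvd hQΦ (RatFunc.denom_div_dvd P Q))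
  refine ⟨Φ, e, he, mul_right_cancel₀ Φ.denom_ne_zero ?_, hQe⟩
  rw [← hcross, hQe]
  ring

theorem exists_minor_ne_zero {a b : K[X]} (h : LinearIndependent K ![a, b]) :
    ∃ i j, a.coeff i * b.coeff j - a.coeff j * b.coeff i ≠ 0 := by
  have ha : a ≠ 0 := h.ne_zero 0
  by_contra! hminor
  refine (LinearIndependent.pair_iff' ha).1 h (b.coeff a.natDegree / a.leadingCoeff) ?_
  ext j
  have hl : a.leadingCoeff ≠ 0 := leadingCoeff_ne_zero.2 ha
  rw [coeff_smul, smul_eq_mul]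
  field_simp
  rw [leadingCoeff]
  linear_combination -hminor a.natDegree j

theorem eventually_eval_ne_zero {r : K[X]} (hr : r ≠ 0) : ∀ᶠ x in cofinite, r.eval x ≠ 0 := by
  simpa only [eventually_cofinite, not_not, IsRoot.def] using finite_setOfPred_isRoot hr

theorem exists_eq_mul_of_mul_eq_mul {p q r s : K} (h : p * s = q * r)
    (hpq : p ≠ 0 ∨ q ≠ 0) (hrs : r ≠ 0 ∨ s ≠ 0) : ∃ c ≠ 0, r = c * p ∧ s = c * q := by
  rcases eq_or_ne p 0 with rfl | hp
  · have hq : q ≠ 0 := by simpa using hpq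
    obtain rfl : r = 0 := by simpa [hq] using h.symm
    exact ⟨s / q, div_ne_zero (by simpa using hrs) hq, (mul_zero _).symm,
      (div_mul_cancel₀ s hq).symm⟩
  · have hs : s = r / p * q := by
      field_simp
      linear_combination h
    refine ⟨r / p, fun hrp => ?_, (div_mul_cancel₀ r hp).symm, hs⟩
    have hr : r = 0 := (div_eq_zero_iff.1 hrp).resolve_right hp
    exact hrs.elim (· hr) (· (by rw [hs, hrp, zero_mul]))

end Univariate

section Factorization

open UniqueFactorizationMonoid

theorem associated_radical_pow {M : Type*} [CommMonoidWithZero M] [NormalizationMonoid M]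
    [UniqueFactorizationMonoid M] {f : M} {m : ℕ} (hf : f ≠ 0)
    (h : ∀ p, Irreducible p → p ∣ f → multiplicity p f = m) : Associated (radical f ^ m) f := by
  classical
  have hfactors : m • (normalizedFactors f).dedup = normalizedFactors f := by
    ext p
    rw [Multiset.count_nsmul, Multiset.count_dedup]
    split_ifs with hp
    · have hirr := irreducible_of_normalized_factor p hp
      rw [← h p hirr (dvd_of_mem_normalizedFactors hp),
        multiplicity_eq_count_normalizedFactors hirr hf, normalize_normalized_factor p hp, mul_one]
    · rw [Multiset.count_eq_zero_of_notMem hp, mul_zero]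
  have hradical : radical f ^ m = (normalizedFactors f).prod := by
    rw [← hfactors, Multiset.prod_nsmul, radical, ← toFinset_normalizedFactors, Finset.prod,
      Multiset.toFinset_val, Multiset.map_id]
  exact hradical ▸ prod_normalizedFactors hf

theorem exists_pow_eq_of_associated {K : Type*} [Field K] [IsAlgClosed K] {f g : K[X][Y]} {m : ℕ}
    (hm : m ≠ 0) (h : Associated (g ^ m) f) : ∃ g' : K[X][Y], Associated g g' ∧ g' ^ m = f := by
  obtain ⟨u, rfl⟩ := h
  obtain ⟨a, ha, hau⟩ := Polynomial.isUnit_iff.1 u.isUnit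
  obtain ⟨c, hc, rfl⟩ := Polynomial.isUnit_iff.1 ha
  obtain ⟨e, rfl⟩ := IsAlgClosed.exists_pow_nat_eq c (Nat.pos_of_ne_zero hm)
  have he : IsUnit (C (C e) : K[X][Y]) := ((isUnit_pow_iff hm).1 hc).map (C.comp C)
  exact ⟨g * C (C e), associated_mul_unit_right g _ he, by rw [mul_pow, ← hau, ← C_pow, ← C_pow]⟩

theorem exists_squarefree_pow_eq {K : Type*} [Field K] [IsAlgClosed K] {f : K[X][Y]} {m : ℕ}
    (hf : f ≠ 0) (hm : m ≠ 0) (h : ∀ p, Irreducible p → p ∣ f → multiplicity p f = m) :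
    ∃ g, Squarefree g ∧ g ^ m = f := by
  classical
  let _ : StrongNormalizationMonoid K[X][Y] :=
    UniqueFactorizationMonoid.strongNormalizationMonoid
  obtain ⟨g, hg, hgf⟩ := exists_pow_eq_of_associated hm (associated_radical_pow hf h)
  exact ⟨g, hg.squarefree_iff.1 squarefree_radical, hgf⟩

end Factorization

section Bivariate

variable {K : Type*} [Field K]

theorem coeff_coeff_swap (f : K[X][Y]) (i j : ℕ) :
    ((swap f).coeff i).coeff j = (f.coeff j).coeff i := by
  induction f using Polynomial.induction_on' with
  | add p q hp hq => simp only [map_add, coeff_add, hp, hq]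
  | monomial n a =>
    induction a using Polynomial.induction_on' with
    | add p q hp hq => simp only [map_add, coeff_add, hp, hq]
    | monomial m r =>
      simp only [swap_monomial_monomial, coeff_monomial]
      split_ifs with hm hn hn <;> simp [coeff_monomial, hm, hn]

theorem eval_map_swap (f : K[X][Y]) (x y : K) :
    ((swap f).map (evalRingHom y)).eval x = (f.map (evalRingHom x)).eval y := by
  simpa only [map_evalRingHom_eval, coe_aevalAeval_eq_evalEval] using aevalAeval_swap y x f

theorem eval_C_eq_map_swap [Infinite K] (f : K[X][Y]) (y : K) :
    f.eval (C y) = (swap f).map (evalRingHom y) := by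
  refine Polynomial.funext fun x => ?_
  rw [eval_map_swap, map_evalRingHom_eval]

theorem natDegree_swap_le_iff {f : K[X][Y]} {d : ℕ} :
    (swap f).natDegree ≤ d ↔ ∀ j, (f.coeff j).natDegree ≤ d := by
  simp only [natDegree_le_iff_coeff_eq_zero, Polynomial.ext_iff, coeff_coeff_swap, coeff_zero]
  exact ⟨fun h j i hi => h i hi j, fun h i hi j => h j i hi⟩

theorem isPrimitive_iff_forall_map_ne_zero [IsAlgClosed K] {f : K[X][Y]} :
    f.IsPrimitive ↔ ∀ x, f.map (evalRingHom x) ≠ 0 := by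
  have hdvd (x : K) : C (X - C x) ∣ f ↔ f.map (evalRingHom x) = 0 := by
    simp only [C_dvd_iff_dvd_coeff, dvd_iff_isRoot, IsRoot.def, Polynomial.ext_iff, coeff_map,
      coe_evalRingHom, coeff_zero]
  refine ⟨fun h x hx => not_isUnit_X_sub_C x (h _ ((hdvd x).2 hx)), fun h r hr => ?_⟩
  by_contra hunit
  obtain ⟨x, hx⟩ := IsAlgClosed.exists_root r (mt isUnit_iff_degree_eq_zero.2 hunit)
  exact h x ((hdvd x).1 ((_root_.map_dvd C (dvd_iff_isRoot.2 hx)).trans hr))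

theorem natDegree_ne_zero_of_isPrimitive {R : Type*} [CommSemiring R] {p : R[X]}
    (hp : p.IsPrimitive) (hunit : ¬ IsUnit p) : p.natDegree ≠ 0 := by
  intro hdeg
  obtain ⟨a, rfl⟩ := natDegree_eq_zero.1 hdeg
  exact hunit ((hp a dvd_rfl).map C)

theorem exists_linearIndependent_coeff [IsAlgClosed K] {f : K[X][Y]} (hf : f.IsPrimitive)
    (hdeg : (swap f).natDegree ≠ 0) :
    ∃ i, LinearIndependent K ![f.leadingCoeff, f.coeff i] := by
  have hlead : f.leadingCoeff ≠ 0 := leadingCoeff_ne_zero.2 hf.ne_zero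
  by_contra! hdep
  simp only [LinearIndependent.pair_iff' hlead, not_forall, not_not] at hdep
  have hunit : IsUnit f.leadingCoeff := hf _ <| (C_dvd_iff_dvd_coeff _ _).2 fun i => by
    obtain ⟨c, hc⟩ := hdep i
    exact hc ▸ dvd_smul_of_dvd c dvd_rfl
  refine hdeg (Nat.le_zero.1 (natDegree_swap_le_iff.2 fun i => ?_))
  obtain ⟨c, hc⟩ := hdep i
  exact hc ▸ (natDegree_smul_le c _).trans (natDegree_eq_zero_of_isUnit hunit).le

end Bivariate

section Generic

variable {K : Type*} [Field K]

theorem resultant_ne_zero_of_not_dvd {R : Type*} [CommRing R] [IsDomain R] [NormalizedGCDMonoid R]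
    {p q : R[X]} (hp : Irreducible p) (hdeg : p.natDegree ≠ 0) (hpq : ¬ p ∣ q) :
    p.resultant q ≠ 0 := by
  let F := FractionRing R
  have hinj := IsFractionRing.injective R F
  have hprim := hp.isPrimitive hdeg
  have hcoprime : IsCoprime (p.map (algebraMap R F)) (q.map (algebraMap R F)) := by
    rwa [(hprim.irreducible_iff_irreducible_map_fraction_map.1 hp).coprime_iff_not_dvd,
      ← hprim.dvd_iff_fraction_map_dvd_fraction_map F]
  intro hres
  have hmap := resultant_map_map p q p.natDegree q.natDegree (algebraMap R F)
  rw [hres, map_zero, ← natDegree_map_eq_of_injective hinj p,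
    ← natDegree_map_eq_of_injective hinj q, resultant_eq_zero_iff] at hmap
  exact hmap.2 hcoprime

theorem eventually_isCoprime_of_prime {p g : K[X][Y]} (hp : Prime p) (hpg : ¬ p ∣ g) :
    ∀ᶠ x in cofinite, IsCoprime (p.map (evalRingHom x)) (g.map (evalRingHom x)) := by
  classical
  by_cases hdeg : p.natDegree = 0
  · obtain ⟨a, rfl⟩ := natDegree_eq_zero.1 hdeg
    filter_upwards [eventually_eval_ne_zero (C_ne_zero.1 hp.ne_zero)] with x hx
    rw [map_C]
    exact isCoprime_one_left.of_isCoprime_of_dvd_left (isUnit_C.2 hx.isUnit).dvd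
  · have hres := resultant_ne_zero_of_not_dvd hp.irreducible hdeg hpg
    obtain ⟨u, v, -, -, huv⟩ := exists_mul_add_mul_eq_C_resultant p g le_rfl le_rfl (Or.inl hdeg)
    filter_upwards [eventually_eval_ne_zero hres] with x hx
    have hdvd := congrArg (Polynomial.map (evalRingHom x)) huv
    rw [Polynomial.map_add, Polynomial.map_mul, Polynomial.map_mul, map_C] at hdvd
    refine IsRelPrime.isCoprime fun r hrp hrg => isUnit_of_dvd_unit ?_ (isUnit_C.2 hx.isUnit)
    exact hdvd ▸ dvd_add (hrp.mul_right _) (hrg.mul_right _)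

theorem eventually_isCoprime {f g : K[X][Y]} (h : IsRelPrime f g) :
    ∀ᶠ x in cofinite, IsCoprime (f.map (evalRingHom x)) (g.map (evalRingHom x)) := by
  induction f using UniqueFactorizationMonoid.induction_on_prime with
  | h₁ =>
    refine .of_forall fun x => ?_
    rw [Polynomial.map_zero, isCoprime_zero_left]
    exact (isRelPrime_zero_left.1 h).map (mapRingHom (evalRingHom x))
  | h₂ f hf =>
    refine .of_forall fun x => isCoprime_one_left.of_isCoprime_of_dvd_left ?_
    exact (hf.map (mapRingHom (evalRingHom x))).dvd
  | h₃ f p _ hp ih =>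
    have hpg := (hp.irreducible.isRelPrime_iff_not_dvd).1 h.of_mul_left_left
    filter_upwards [eventually_isCoprime_of_prime hp hpg, ih h.of_mul_left_right] with x hpx hfx
    rw [Polynomial.map_mul]
    exact hpx.mul_left hfx

theorem not_dvd_derivative {R : Type*} [CommRing R] [IsDomain R] [CharZero R] {p : R[X]}
    (hdeg : p.natDegree ≠ 0) : ¬ p ∣ derivative p := fun h =>
  (natDegree_derivative_lt hdeg).not_ge <|
    natDegree_le_of_dvd h (mt derivative_eq_zero.1 hdeg)

theorem isRelPrime_derivative {R : Type*} [CommRing R] [IsDomain R] [CharZero R]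
    [UniqueFactorizationMonoid R] {f : R[X]} (hf : Squarefree f) (hprim : f.IsPrimitive) :
    IsRelPrime f (derivative f) := by
  refine WfDvdMonoid.isRelPrime_of_no_irreducible_factors (fun h => hprim.ne_zero h.1) ?_
  rintro p hp ⟨q, rfl⟩ hderiv
  have hdeg := natDegree_ne_zero_of_isPrimitive (isPrimitive_of_dvd hprim (dvd_mul_right p q))
    hp.not_isUnit
  rw [derivative_mul, dvd_add_left (dvd_mul_right p _)] at hderiv
  have hpq : p ∣ q := (hp.prime.dvd_or_dvd hderiv).resolve_left (not_dvd_derivative hdeg)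
  exact hp.not_isUnit (hf p (mul_dvd_mul_left p hpq))

theorem eventually_separable [CharZero K] {f : K[X][Y]} (hf : Squarefree f)
    (hprim : f.IsPrimitive) : ∀ᶠ x in cofinite, (f.map (evalRingHom x)).Separable := by
  filter_upwards [eventually_isCoprime (isRelPrime_derivative hf hprim)] with x hx
  rwa [Separable, derivative_map]

theorem eventually_natDegree_map_eq {f : K[X][Y]} (hf : f ≠ 0) :
    ∀ᶠ x in cofinite, (f.map (evalRingHom x)).natDegree = f.natDegree := by
  filter_upwards [eventually_eval_ne_zero (leadingCoeff_ne_zero.2 hf)] with x hx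
  exact natDegree_map_of_leadingCoeff_ne_zero (evalRingHom x) hx

theorem eventually_exists_rootMultiplicity_eq [IsAlgClosed K] [CharZero K] {p h : K[X][Y]}
    (hp : Irreducible p) (hdeg : p.natDegree ≠ 0) (hdeg' : (swap p).natDegree ≠ 0)
    (hph : ¬ p ∣ h) (m : ℕ) : ∀ᶠ x in cofinite, ∃ y, (p.map (evalRingHom x)).IsRoot y ∧
      ((swap (p ^ m * h)).map (evalRingHom y)).rootMultiplicity x = m := by
  have hsimple : ¬ p ∣ swap (derivative (swap p)) := fun hd => not_dvd_derivative hdeg' <| by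
    simpa only [swap_swap_apply] using _root_.map_dvd swap hd
  filter_upwards [eventually_isCoprime_of_prime hp.prime (hp.prime.not_dvd_mul hph hsimple),
    eventually_natDegree_map_eq hp.ne_zero] with x hcoprime hx
  obtain ⟨y, hy⟩ := IsAlgClosed.exists_root (p.map (evalRingHom x)) fun h0 =>
    hdeg (hx ▸ natDegree_eq_of_degree_eq_some h0)
  have hunit := hcoprime.map (evalRingHom y)
  rw [coe_evalRingHom, hy.eq_zero, isCoprime_zero_left, Polynomial.map_mul, eval_mul,
    ← eval_map_swap h x y, ← eval_map_swap (swap _) x y, swap_swap_apply, ← derivative_map] at hunit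
  refine ⟨y, hy, ?_⟩
  rw [map_mul, map_pow, Polynomial.map_mul, Polynomial.map_pow]
  refine rootMultiplicity_pow_mul ?_ ?_ ?_ m
  · rwa [IsRoot.def, eval_map_swap]
  · exact (isUnit_of_mul_isUnit_right hunit).ne_zero
  · exact (isUnit_of_mul_isUnit_left hunit).ne_zero

theorem eventually_forall_isRoot_eval_ne_zero [IsAlgClosed K] {f : K[X][Y]} {a : K[X]}
    (hf : (swap f).IsPrimitive) (ha : a ≠ 0) :
    ∀ᶠ x in cofinite, ∀ y, (f.map (evalRingHom x)).IsRoot y → a.eval y ≠ 0 := by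
  have hzeros : ∀ᶠ x in cofinite, ∀ y ∈ {y | a.IsRoot y},
      ((swap f).map (evalRingHom y)).eval x ≠ 0 :=
    (eventually_all_finite (finite_setOfPred_isRoot ha)).2 fun y _ =>
      eventually_eval_ne_zero (isPrimitive_iff_forall_map_ne_zero.1 hf y)
  filter_upwards [hzeros] with x hx y hy hay
  exact hx y hay (eval_map_swap f x y ▸ hy)

end Generic

section CrossDiff

variable {K : Type*} [Field K] {P Q R S : K[X]}

/-- The numerator `P(x) S(y) - Q(x) R(y)` of `P(x) / Q(x) - R(y) / S(y)`, for fractions that need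
not be in lowest terms. -/
def crossDiff (P Q R S : K[X]) : K[X][Y] := C P * S.map C - C Q * R.map C

theorem swap_crossDiff (P Q R S : K[X]) : swap (crossDiff P Q R S) = crossDiff S R Q P := by
  simp only [crossDiff, map_sub, map_mul, swap_C, swap_map_C]
  ring

theorem crossDiff_C_mul (e e' : K) (P Q R S : K[X]) :
    crossDiff (C e * P) (C e * Q) (C e' * R) (C e' * S) =
      C (C (e * e')) * crossDiff P Q R S := by
  simp only [crossDiff, Polynomial.map_mul, map_C, C_mul]
  ring

theorem coeff_crossDiff (P Q R S : K[X]) (n : ℕ) :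
    (crossDiff P Q R S).coeff n = C (S.coeff n) * P - C (R.coeff n) * Q := by
  rw [crossDiff, coeff_sub, coeff_C_mul, coeff_C_mul, coeff_map, coeff_map, mul_comm P, mul_comm Q]

theorem isCoprime_of_isPrimitive_crossDiff (h : (crossDiff P Q R S).IsPrimitive) :
    IsCoprime P Q :=
  IsRelPrime.isCoprime fun _ hP hQ =>
    h _ (dvd_sub (dvd_mul_of_dvd_left (_root_.map_dvd C hP) _)
      (dvd_mul_of_dvd_left (_root_.map_dvd C hQ) _))

theorem natDegree_swap_crossDiff_le (P Q R S : K[X]) :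
    (swap (crossDiff P Q R S)).natDegree ≤ max P.natDegree Q.natDegree :=
  natDegree_swap_le_iff.2 fun n => by
    rw [coeff_crossDiff]
    exact (natDegree_sub_le _ _).trans
      (max_le_max (natDegree_C_mul_le _ _) (natDegree_C_mul_le _ _))

theorem exists_eq_crossDiff [Infinite K] {d : ℕ} {f : K[X][Y]}
    (hRS : LinearIndependent K ![R, S]) (hf : (swap f).natDegree ≤ d)
    (h : ∀ᶠ x in cofinite, ∃ u v : K, f.map (evalRingHom x) = C u * S - C v * R) :
    ∃ P Q : K[X], P.natDegree ≤ d ∧ Q.natDegree ≤ d ∧ f = crossDiff P Q R S := by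
  obtain ⟨i, j, hminor⟩ := exists_minor_ne_zero hRS
  set D := R.coeff i * S.coeff j - R.coeff j * S.coeff i with hD
  have hdeg (c e : K) : (C c * f.coeff i - C e * f.coeff j).natDegree ≤ d :=
    (natDegree_sub_le _ _).trans <| max_le
      ((natDegree_C_mul_le _ _).trans (natDegree_swap_le_iff.1 hf i))
      ((natDegree_C_mul_le _ _).trans (natDegree_swap_le_iff.1 hf j))
  -- Cramer's rule, solving for `P(x)` and `Q(x)` from the coefficients of `y ^ i` and `y ^ j`.
  refine ⟨C (-R.coeff j / D) * f.coeff i - C (-R.coeff i / D) * f.coeff j,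
    C (-S.coeff j / D) * f.coeff i - C (-S.coeff i / D) * f.coeff j, hdeg _ _, hdeg _ _, ?_⟩
  refine Polynomial.ext fun n => eq_of_infinite_eval_eq _ _ <|
    frequently_cofinite_iff_infinite.1 (h.mono fun x hx => ?_).frequently
  obtain ⟨u, v, huv⟩ := hx
  have hcoeff (n : ℕ) : (f.coeff n).eval x = u * S.coeff n - v * R.coeff n := by
    simpa using congrArg (coeff · n) huv
  simp only [coeff_crossDiff, eval_sub, eval_mul, eval_C, hcoeff]
  field_simp
  rw [hD]
  ring

end CrossDiff

section Slices

/-- The value at `v = (ξ, x)` of the binary form `∑ pᵢ x ^ i ξ ^ (d - i)` of degree `d`, which is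
the homogenization of `p` when `p.natDegree ≤ d`. -/
def homEval (d : ℕ) (p : ℂ[X]) (v : ℂ × ℂ) : ℂ :=
  ∑ i ∈ Finset.range (d + 1), p.coeff i * (v.2 ^ i * v.1 ^ (d - i))

theorem hcoords_coe (z : ℂ) : hcoords z = (1, z) := rfl

theorem hcoords_infty : hcoords OnePoint.infty = (0, 1) := rfl

theorem homEval_hcoords_coe {d : ℕ} {p : ℂ[X]} (hp : p.natDegree ≤ d) (z : ℂ) :
    homEval d p (hcoords z) = p.eval z := by
  rw [eval_eq_sum_range' (Nat.lt_succ_of_le hp)]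
  exact Finset.sum_congr rfl fun i _ => by rw [hcoords_coe, one_pow, mul_one]

theorem homEval_hcoords_infty (d : ℕ) (p : ℂ[X]) :
    homEval d p (hcoords OnePoint.infty) = p.coeff d := by
  rw [homEval, Finset.sum_eq_single_of_mem d (Finset.self_mem_range_succ d)]
  · simp [hcoords_infty]
  · intro i hi hne
    have hlt : d - i ≠ 0 := by grind
    simp [hcoords_infty, hlt]

theorem homEval_C_mul_sub_C_mul (d : ℕ) (a b : ℂ) (p q : ℂ[X]) (v : ℂ × ℂ) :
    homEval d (C a * p - C b * q) v = a * homEval d p v - b * homEval d q v := by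
  simp only [homEval, coeff_sub, coeff_C_mul, Finset.mul_sum, ← Finset.sum_sub_distrib]
  exact Finset.sum_congr rfl fun i _ => by ring

theorem coeff_sliceY (d : ℕ) (f : ℂ[X][Y]) (p : ℂ × ℂ) (n : ℕ) :
    (sliceY d f p).coeff n = if n ≤ d then homEval d (f.coeff n) p else 0 := by
  simp [sliceY, homEval, coeffXY, coeff_C_mul, coeff_X_pow, -map_sum]

theorem natDegree_sliceY_le (d : ℕ) (f : ℂ[X][Y]) (p : ℂ × ℂ) : (sliceY d f p).natDegree ≤ d :=
  natDegree_le_iff_coeff_eq_zero.2 fun n hn => by rw [coeff_sliceY, if_neg hn.not_ge]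

theorem biform_eq_homEval_sliceY (d : ℕ) (f : ℂ[X][Y]) (p q : ℂ × ℂ) :
    biform d f p q = homEval d (sliceY d f p) q := by
  rw [biform, Finset.sum_comm, homEval]
  refine Finset.sum_congr rfl fun j hj => ?_
  rw [coeff_sliceY, if_pos (Finset.mem_range_succ_iff.1 hj), homEval, Finset.sum_mul]
  rfl

theorem coeffXY_swap (f : ℂ[X][Y]) (i j : ℕ) : coeffXY (swap f) i j = coeffXY f j i :=
  coeff_coeff_swap f j i

theorem biform_swap (d : ℕ) (f : ℂ[X][Y]) (p q : ℂ × ℂ) :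
    biform d (swap f) q p = biform d f p q := by
  rw [biform, biform, Finset.sum_comm]
  simp only [coeffXY_swap, mul_right_comm]

theorem sliceX_eq_sliceY_swap (d : ℕ) (f : ℂ[X][Y]) (q : ℂ × ℂ) :
    sliceX d f q = sliceY d (swap f) q := by
  simp only [sliceX, sliceY, coeffXY_swap]

theorem fiberX_eq_fiberY_swap (d : ℕ) (f : ℂ[X][Y]) (y : OnePoint ℂ) :
    fiberX d f y = fiberY d (swap f) y := by
  rw [fiberX, fiberY, sliceX_eq_sliceY_swap]

theorem fiberX_swap (d : ℕ) (f : ℂ[X][Y]) (x : OnePoint ℂ) :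
    fiberX d (swap f) x = fiberY d f x := by
  rw [fiberX_eq_fiberY_swap, swap_swap_apply]

theorem sliceY_hcoords_coe {d : ℕ} {f : ℂ[X][Y]} (hf : f.natDegree ≤ d)
    (hs : (swap f).natDegree ≤ d) (z : ℂ) :
    sliceY d f (hcoords z) = f.map (evalRingHom z) := by
  ext n
  rw [coeff_sliceY, homEval_hcoords_coe (natDegree_swap_le_iff.1 hs n), coeff_map, coe_evalRingHom]
  split_ifs with hn
  · rfl
  · rw [coeff_eq_zero_of_natDegree_lt (hf.trans_lt (not_le.1 hn)), eval_zero]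

theorem sliceY_hcoords_infty {d : ℕ} {f : ℂ[X][Y]} (hf : f.natDegree ≤ d) :
    sliceY d f (hcoords OnePoint.infty) = (swap f).coeff d := by
  ext n
  rw [coeff_sliceY, homEval_hcoords_infty, coeff_coeff_swap]
  split_ifs with hn
  · rfl
  · rw [coeff_eq_zero_of_natDegree_lt (hf.trans_lt (not_le.1 hn)), coeff_zero]

theorem sliceY_pow {k : ℕ} {g : ℂ[X][Y]} (hg : g.natDegree ≤ k) (hs : (swap g).natDegree ≤ k)
    (m : ℕ) (a : OnePoint ℂ) :
    sliceY (m * k) (g ^ m) (hcoords a) = sliceY k g (hcoords a) ^ m := by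
  have hgm : (g ^ m).natDegree ≤ m * k := natDegree_pow_le_of_le m hg
  have hsm : (swap (g ^ m)).natDegree ≤ m * k := map_pow swap g m ▸ natDegree_pow_le_of_le m hs
  induction a using OnePoint.rec with
  | infty =>
    rw [sliceY_hcoords_infty hgm, sliceY_hcoords_infty hg, map_pow, coeff_pow_of_natDegree_le hs]
  | coe z => rw [sliceY_hcoords_coe hgm hsm, sliceY_hcoords_coe hg hs, Polynomial.map_pow]

theorem forall_sliceY_ne_zero_iff {d : ℕ} {f : ℂ[X][Y]} (hf : f.natDegree ≤ d)
    (hs : (swap f).natDegree ≤ d) : (∀ a, sliceY d f (hcoords a) ≠ 0) ↔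
      f.IsPrimitive ∧ (swap f).natDegree = d := by
  rw [OnePoint.forall, sliceY_hcoords_infty hf, isPrimitive_iff_forall_map_ne_zero, and_comm]
  simp only [sliceY_hcoords_coe hf hs]
  refine and_congr_right fun h => ⟨fun hd => hs.antisymm (le_natDegree_of_ne_zero hd), ?_⟩
  rintro rfl
  refine leadingCoeff_ne_zero.2 <| (map_ne_zero_iff swap swap.injective).2 ?_
  rintro rfl
  exact h 0 (Polynomial.map_zero _)

end Slices

section SphereRoots

theorem mem_sphereRoots {d : ℕ} {p : ℂ[X]} (hp : p ≠ 0) (hdeg : p.natDegree ≤ d)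
    {b : OnePoint ℂ} : b ∈ sphereRoots d p ↔ homEval d p (hcoords b) = 0 := by
  rw [sphereRoots, Multiset.mem_add, Multiset.mem_replicate]
  induction b using OnePoint.rec with
  | infty =>
    have hinfty : OnePoint.infty ∉ p.roots.map ((↑) : ℂ → OnePoint ℂ) := by simp
    have hcoeff : p.coeff d ≠ 0 ↔ p.natDegree = d :=
      ⟨fun h => hdeg.antisymm (le_natDegree_of_ne_zero h),
        fun h => h ▸ leadingCoeff_ne_zero.2 hp⟩
    rw [homEval_hcoords_infty]
    grind
  | coe w =>
    rw [homEval_hcoords_coe hdeg]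
    simp [hp]

theorem eq_zero_iff_homEval_hcoords {d : ℕ} {p : ℂ[X]} (hdeg : p.natDegree ≤ d) :
    p = 0 ↔ ∀ b, homEval d p (hcoords b) = 0 := by
  refine ⟨?_, fun h => Polynomial.funext fun w => ?_⟩
  · rintro rfl b
    simp [homEval]
  · rw [← homEval_hcoords_coe hdeg, h, eval_zero]

theorem roots_eq_of_sphereRoots_eq {d : ℕ} {p q : ℂ[X]} (h : sphereRoots d p = sphereRoots d q) :
    p.roots = q.roots := by
  classical
  have hcount (r : ℂ[X]) (z : ℂ) : r.roots.count z = (sphereRoots d r).count (z : OnePoint ℂ) := by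
    rw [sphereRoots, Multiset.count_add, Multiset.count_map_eq_count' _ _ OnePoint.coe_injective,
      Multiset.count_replicate, if_neg (OnePoint.infty_ne_coe z), add_zero]
  ext z
  rw [hcount, hcount, h]

theorem sphereRoots_C_mul (d : ℕ) {c : ℂ} (hc : c ≠ 0) (p : ℂ[X]) :
    sphereRoots d (C c * p) = sphereRoots d p := by
  rw [sphereRoots, sphereRoots, roots_C_mul _ hc, natDegree_C_mul hc]

theorem sphereRoots_pow (k m : ℕ) (p : ℂ[X]) :
    sphereRoots (m * k) (p ^ m) = m • sphereRoots k p := by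
  rw [sphereRoots, sphereRoots, roots_pow, natDegree_pow, nsmul_add, Multiset.map_nsmul,
    Multiset.nsmul_replicate, Nat.mul_sub]

theorem vertical_subset_graph_iff {d : ℕ} {f : ℂ[X][Y]} {a : OnePoint ℂ} :
    ({a} : Set (OnePoint ℂ)) ×ˢ Set.univ ⊆ graph d f ↔ sliceY d f (hcoords a) = 0 := by
  rw [eq_zero_iff_homEval_hcoords (natDegree_sliceY_le d f _)]
  simp only [Set.singleton_prod, Set.image_univ, Set.range_subset_iff, graph, Set.mem_ofPred_eq,
    biform_eq_homEval_sliceY]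

theorem horizontal_subset_graph_iff {d : ℕ} {f : ℂ[X][Y]} {a : OnePoint ℂ} :
    Set.univ ×ˢ ({a} : Set (OnePoint ℂ)) ⊆ graph d f ↔ sliceY d (swap f) (hcoords a) = 0 := by
  rw [eq_zero_iff_homEval_hcoords (natDegree_sliceY_le d (swap f) _)]
  simp only [Set.prod_singleton, Set.image_univ, Set.range_subset_iff, graph, Set.mem_ofPred_eq,
    ← biform_eq_homEval_sliceY, biform_swap]

end SphereRoots

section Correspondence

variable {d : ℕ} {f : ℂ[X][Y]}

theorem finite_card_roots_ne_iff (hf : f ≠ 0) :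
    {x : ℂ | (f.map (evalRingHom x)).roots.card ≠ d}.Finite ↔ f.natDegree = d := by
  change (∀ᶠ x in cofinite, (f.map (evalRingHom x)).roots.card = d) ↔ _
  simp only [← (IsAlgClosed.splits _).natDegree_eq_card_roots]
  have hgeneric := eventually_natDegree_map_eq hf
  refine ⟨fun h => ?_, fun h => h ▸ hgeneric⟩
  obtain ⟨x, hx, hd⟩ := (hgeneric.and h).exists
  exact hx.symm.trans hd

theorem isCorrespondence_iff : IsCorrespondence d f ↔ f.natDegree = d ∧ (swap f).natDegree = d ∧
    f.IsPrimitive ∧ (swap f).IsPrimitive := by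
  have hlines : IsCorrespondence d f ↔
      ({x : ℂ | (f.map (evalRingHom x)).roots.card ≠ d}.Finite ∧
        {y : ℂ | ((swap f).map (evalRingHom y)).roots.card ≠ d}.Finite) ∧
      (∀ a, sliceY d f (hcoords a) ≠ 0) ∧ ∀ a, sliceY d (swap f) (hcoords a) ≠ 0 := by
    simp only [← eval_C_eq_map_swap]
    exact ⟨fun h => ⟨⟨h.1, h.2⟩, fun a => mt vertical_subset_graph_iff.2 (h.3 a),
      fun a => mt horizontal_subset_graph_iff.2 (h.4 a)⟩, fun h => ⟨h.1.1, h.1.2,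
      fun a => mt vertical_subset_graph_iff.1 (h.2.1 a),
      fun a => mt horizontal_subset_graph_iff.1 (h.2.2 a)⟩⟩
  rcases eq_or_ne f 0 with rfl | hf
  · have hline : sliceY d 0 (hcoords OnePoint.infty) = 0 := by simp [sliceY, coeffXY]
    exact iff_of_false (fun h => (hlines.1 h).2.1 _ hline) fun h => h.2.2.1.ne_zero rfl
  have hs : swap f ≠ 0 := (map_ne_zero_iff swap swap.injective).2 hf
  rw [hlines, finite_card_roots_ne_iff hf, finite_card_roots_ne_iff hs, and_assoc]
  refine and_congr_right fun hd => and_congr_right fun hd' => ?_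
  have hd'' : (swap (swap f)).natDegree = d := by rwa [swap_swap_apply]
  rw [forall_sliceY_ne_zero_iff hd.le hd'.le, forall_sliceY_ne_zero_iff hd'.le hd''.le]
  tauto

theorem IsCorrespondence.natDegree_eq (hf : IsCorrespondence d f) : f.natDegree = d :=
  (isCorrespondence_iff.1 hf).1

theorem IsCorrespondence.isPrimitive (hf : IsCorrespondence d f) : f.IsPrimitive :=
  (isCorrespondence_iff.1 hf).2.2.1

protected theorem IsCorrespondence.swap (hf : IsCorrespondence d f) :
    IsCorrespondence d (swap f) := by
  obtain ⟨hd, hd', hp, hp'⟩ := isCorrespondence_iff.1 hf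
  rw [isCorrespondence_iff, swap_swap_apply]
  exact ⟨hd', hd, hp', hp⟩

theorem IsCorrespondence.natDegree_coeff_le (hf : IsCorrespondence d f) (n : ℕ) :
    (f.coeff n).natDegree ≤ d :=
  natDegree_swap_le_iff.1 hf.swap.natDegree_eq.le n

theorem IsCorrespondence.sliceY_ne_zero (hf : IsCorrespondence d f) (a : OnePoint ℂ) :
    sliceY d f (hcoords a) ≠ 0 :=
  (forall_sliceY_ne_zero_iff hf.natDegree_eq.le hf.swap.natDegree_eq.le).2
    ⟨hf.isPrimitive, hf.swap.natDegree_eq⟩ a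

theorem IsCorrespondence.fiberY_coe (hf : IsCorrespondence d f) (x : ℂ) :
    fiberY d f x = sphereRoots d (f.map (evalRingHom x)) := by
  rw [fiberY, sliceY_hcoords_coe hf.natDegree_eq.le hf.swap.natDegree_eq.le]

theorem IsCorrespondence.mem_fiberY (hf : IsCorrespondence d f) {a b : OnePoint ℂ} :
    b ∈ fiberY d f a ↔ biform d f (hcoords a) (hcoords b) = 0 := by
  rw [fiberY, mem_sphereRoots (hf.sliceY_ne_zero a) (natDegree_sliceY_le d f _),
    biform_eq_homEval_sliceY]

theorem IsCorrespondence.coe_mem_fiberY_coe (hf : IsCorrespondence d f) {x y : ℂ} :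
    (y : OnePoint ℂ) ∈ fiberY d f x ↔ (f.map (evalRingHom x)).IsRoot y := by
  have hle := natDegree_sliceY_le d f (hcoords x)
  rw [hf.mem_fiberY, biform_eq_homEval_sliceY, homEval_hcoords_coe hle,
    sliceY_hcoords_coe hf.natDegree_eq.le hf.swap.natDegree_eq.le, IsRoot.def]

theorem isCorrespondence_pow_iff {k m : ℕ} {g : ℂ[X][Y]} (hm : m ≠ 0) :
    IsCorrespondence (m * k) (g ^ m) ↔ IsCorrespondence k g := by
  have hprim (h : ℂ[X][Y]) : (h ^ m).IsPrimitive ↔ h.IsPrimitive := by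
    simp only [isPrimitive_iff_forall_map_ne_zero, Polynomial.map_pow, ne_eq, pow_eq_zero_iff hm]
  simp only [isCorrespondence_iff, map_pow, hprim, natDegree_pow, mul_right_inj' hm]

theorem IsCorrespondence.fiberY_pow {k : ℕ} {g : ℂ[X][Y]} (hg : IsCorrespondence k g) (m : ℕ)
    (a : OnePoint ℂ) : fiberY (m * k) (g ^ m) a = m • fiberY k g a := by
  rw [fiberY, fiberY, sliceY_pow hg.natDegree_eq.le hg.swap.natDegree_eq.le, sphereRoots_pow]

theorem IsCorrespondence.fiberX_pow {k : ℕ} {g : ℂ[X][Y]} (hg : IsCorrespondence k g) (m : ℕ)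
    (b : OnePoint ℂ) : fiberX (m * k) (g ^ m) b = m • fiberX k g b := by
  rw [fiberX_eq_fiberY_swap, fiberX_eq_fiberY_swap, map_pow, hg.swap.fiberY_pow]

theorem isMapOfTuples_iff : IsMapOfTuples d f ↔ IsCorrespondence d f ∧
    (∀ x, ∀ y ∈ fiberY d f x, ∀ y' ∈ fiberY d f x, fiberX d f y = fiberX d f y') ∧
    ∀ y, ∀ x ∈ fiberX d f y, ∀ x' ∈ fiberX d f y, fiberY d f x = fiberY d f x' :=
  ⟨fun h => ⟨h.1, h.2, h.3⟩, fun h => ⟨h.1, h.2.1, h.2.2⟩⟩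

protected theorem IsMapOfTuples.swap (hf : IsMapOfTuples d f) : IsMapOfTuples d (swap f) := by
  rw [isMapOfTuples_iff] at hf ⊢
  simp only [fiberX_swap, ← fiberX_eq_fiberY_swap]
  exact ⟨hf.1.swap, hf.2.2, hf.2.1⟩

theorem isMapOfTuples_pow_iff {k m : ℕ} {g : ℂ[X][Y]} (hm : m ≠ 0) :
    IsMapOfTuples (m * k) (g ^ m) ↔ IsMapOfTuples k g := by
  have hinj : Function.Injective fun s : Multiset (OnePoint ℂ) => m • s :=
    nsmul_right_injective hm
  rw [isMapOfTuples_iff, isMapOfTuples_iff, isCorrespondence_pow_iff hm]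
  refine and_congr_right fun hg => ?_
  simp only [hg.fiberX_pow, hg.fiberY_pow, Multiset.mem_nsmul_of_ne_zero hm, hinj.eq_iff]

end Correspondence

section Separation

variable {d : ℕ} {P Q R S : ℂ[X]}

theorem sliceY_crossDiff (P Q : ℂ[X]) (hR : R.natDegree ≤ d) (hS : S.natDegree ≤ d) (p : ℂ × ℂ) :
    sliceY d (crossDiff P Q R S) p = C (homEval d P p) * S - C (homEval d Q p) * R := by
  ext n
  rw [coeff_sliceY, coeff_sub, coeff_C_mul, coeff_C_mul]
  split_ifs with hn
  · rw [coeff_crossDiff, homEval_C_mul_sub_C_mul, mul_comm, mul_comm (R.coeff n)]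
  · rw [coeff_eq_zero_of_natDegree_lt (hR.trans_lt (not_le.1 hn)),
      coeff_eq_zero_of_natDegree_lt (hS.trans_lt (not_le.1 hn)), mul_zero, mul_zero, sub_zero]

theorem biform_crossDiff (P Q : ℂ[X]) (hR : R.natDegree ≤ d) (hS : S.natDegree ≤ d)
    (p q : ℂ × ℂ) : biform d (crossDiff P Q R S) p q =
      homEval d P p * homEval d S q - homEval d Q p * homEval d R q := by
  rw [biform_eq_homEval_sliceY, sliceY_crossDiff P Q hR hS, homEval_C_mul_sub_C_mul]

theorem homEval_ne_zero_or_homEval_ne_zero (hR : R.natDegree ≤ d) (hS : S.natDegree ≤ d)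
    (h : IsCorrespondence d (crossDiff P Q R S)) (a : OnePoint ℂ) :
    homEval d P (hcoords a) ≠ 0 ∨ homEval d Q (hcoords a) ≠ 0 := by
  by_contra! hPQ
  refine h.sliceY_ne_zero a ?_
  rw [sliceY_crossDiff P Q hR hS, hPQ.1, hPQ.2, C_0, zero_mul, zero_mul, sub_zero]

theorem fiberX_crossDiff (hP : P.natDegree ≤ d) (hQ : Q.natDegree ≤ d) (hR : R.natDegree ≤ d)
    (hS : S.natDegree ≤ d) (h : IsCorrespondence d (crossDiff P Q R S)) {a b : OnePoint ℂ}
    (hb : b ∈ fiberY d (crossDiff P Q R S) a) : fiberX d (crossDiff P Q R S) b =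
      sphereRoots d (C (homEval d Q (hcoords a)) * P - C (homEval d P (hcoords a)) * Q) := by
  have hswap : IsCorrespondence d (crossDiff S R Q P) := swap_crossDiff P Q R S ▸ h.swap
  rw [h.mem_fiberY, biform_crossDiff P Q hR hS, sub_eq_zero] at hb
  obtain ⟨c, hc, hr, hs⟩ := exists_eq_mul_of_mul_eq_mul hb
    (homEval_ne_zero_or_homEval_ne_zero hR hS h a)
    (homEval_ne_zero_or_homEval_ne_zero hQ hP hswap b).symm
  rw [fiberX_eq_fiberY_swap, swap_crossDiff, fiberY, sliceY_crossDiff S R hQ hP, hr, hs]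
  rw [C_mul, C_mul, mul_assoc, mul_assoc, ← mul_sub, sphereRoots_C_mul d hc]

theorem isMapOfTuples_crossDiff (hP : P.natDegree ≤ d) (hQ : Q.natDegree ≤ d)
    (hR : R.natDegree ≤ d) (hS : S.natDegree ≤ d) (h : IsCorrespondence d (crossDiff P Q R S)) :
    IsMapOfTuples d (crossDiff P Q R S) := by
  have hswap : IsCorrespondence d (crossDiff S R Q P) := swap_crossDiff P Q R S ▸ h.swap
  refine ⟨h, fun a b hb b' hb' => ?_, fun b a ha a' ha' => ?_⟩
  · rw [fiberX_crossDiff hP hQ hR hS h hb, fiberX_crossDiff hP hQ hR hS h hb']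
  · rw [fiberX_eq_fiberY_swap, swap_crossDiff] at ha ha'
    rw [← fiberX_swap, ← fiberX_swap, swap_crossDiff, fiberX_crossDiff hS hR hQ hP hswap ha,
      fiberX_crossDiff hS hR hQ hP hswap ha']

theorem max_natDegree_eq_of_isCorrespondence (hP : P.natDegree ≤ d) (hQ : Q.natDegree ≤ d)
    (h : IsCorrespondence d (crossDiff P Q R S)) : max P.natDegree Q.natDegree = d :=
  (max_le hP hQ).antisymm <|
    h.swap.natDegree_eq.symm.trans_le (natDegree_swap_crossDiff_le P Q R S)

theorem exists_ratFunc_of_isCoprime (hd : d ≠ 0) (hPQ : IsCoprime P Q)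
    (hmax : max P.natDegree Q.natDegree = d) : ∃ (Φ : RatFunc ℂ) (e : ℂ),
      e ≠ 0 ∧ ratDegree Φ = d ∧ P = C e * Φ.num ∧ Q = C e * Φ.denom := by
  have hQ : Q ≠ 0 := by
    rintro rfl
    have hunit : IsUnit P := isCoprime_zero_right.1 hPQ
    rw [natDegree_eq_zero_of_isUnit hunit, natDegree_zero, max_self] at hmax
    exact hd hmax.symm
  obtain ⟨Φ, e, he, rfl, rfl⟩ := exists_eq_C_mul_num_denom hPQ hQ
  rw [natDegree_C_mul he, natDegree_C_mul he] at hmax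
  exact ⟨Φ, e, he, hmax, rfl, rfl⟩

theorem isSeparable_crossDiff (hd : d ≠ 0) (hP : P.natDegree ≤ d) (hQ : Q.natDegree ≤ d)
    (hR : R.natDegree ≤ d) (hS : S.natDegree ≤ d) (h : IsCorrespondence d (crossDiff P Q R S)) :
    IsSeparable d (crossDiff P Q R S) := by
  have hswap : IsCorrespondence d (crossDiff S R Q P) := swap_crossDiff P Q R S ▸ h.swap
  obtain ⟨Φ, e, he, hΦ, rfl, rfl⟩ := exists_ratFunc_of_isCoprime hd
    (isCoprime_of_isPrimitive_crossDiff h.isPrimitive)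
    (max_natDegree_eq_of_isCorrespondence hP hQ h)
  obtain ⟨Ψ, e', he', hΨ, rfl, rfl⟩ := exists_ratFunc_of_isCoprime hd
    (isCoprime_of_isPrimitive_crossDiff hswap.isPrimitive).symm
    ((max_comm _ _).trans (max_natDegree_eq_of_isCorrespondence hS hR hswap))
  exact ⟨Φ, Ψ, hΦ, hΨ, e * e', mul_ne_zero he he', crossDiff_C_mul e e' _ _ _ _⟩

theorem IsSeparable.isMapOfTuples {f : ℂ[X][Y]} (hs : IsSeparable d f)
    (hf : IsCorrespondence d f) : IsMapOfTuples d f := by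
  obtain ⟨Φ, Ψ, rfl, hΨ, c, -, rfl⟩ := hs
  have hcross : C (C c) * separatedPoly Φ Ψ =
      crossDiff (C c * Φ.num) (C c * Φ.denom) Ψ.num Ψ.denom := by
    have h := crossDiff_C_mul c 1 Φ.num Φ.denom Ψ.num Ψ.denom
    rw [C_1, one_mul, one_mul, mul_one] at h
    exact h.symm
  rw [hcross] at hf ⊢
  refine isMapOfTuples_crossDiff ?_ ?_ ?_ ?_ hf
  · exact (natDegree_C_mul_le _ _).trans (le_max_left _ _)
  · exact (natDegree_C_mul_le _ _).trans (le_max_right _ _)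
  · exact hΨ ▸ le_max_left _ _
  · exact hΨ ▸ le_max_right _ _

end Separation

section MapOfTuples

variable {d : ℕ} {f : ℂ[X][Y]}

theorem IsMapOfTuples.associated_map_swap (hf : IsMapOfTuples d f) {x y y' : ℂ}
    (hy : (f.map (evalRingHom x)).IsRoot y) (hy' : (f.map (evalRingHom x)).IsRoot y') :
    Associated ((swap f).map (evalRingHom y)) ((swap f).map (evalRingHom y')) := by
  have hne := isPrimitive_iff_forall_map_ne_zero.1 hf.corr.swap.isPrimitive
  have hfiber : fiberX d f y = fiberX d f y' :=
    hf.coincide_x x y (hf.corr.coe_mem_fiberY_coe.2 hy) y' (hf.corr.coe_mem_fiberY_coe.2 hy')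
  rw [fiberX_eq_fiberY_swap, fiberX_eq_fiberY_swap, hf.corr.swap.fiberY_coe,
    hf.corr.swap.fiberY_coe] at hfiber
  exact (IsAlgClosed.associated_iff_roots_eq_roots (hne y) (hne y')).2
    (roots_eq_of_sphereRoots_eq hfiber)

theorem IsMapOfTuples.eventually_exists_rootMultiplicity_eq (hf : IsMapOfTuples d f)
    {p : ℂ[X][Y]} (hp : Irreducible p) (hpf : p ∣ f) :
    ∀ᶠ x in cofinite, ∃ y, (f.map (evalRingHom x)).IsRoot y ∧
      ((swap f).map (evalRingHom y)).rootMultiplicity x = multiplicity p f := by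
  have hdeg := natDegree_ne_zero_of_isPrimitive (isPrimitive_of_dvd hf.corr.isPrimitive hpf)
    hp.not_isUnit
  have hdeg' := natDegree_ne_zero_of_isPrimitive
    (isPrimitive_of_dvd hf.corr.swap.isPrimitive (_root_.map_dvd swap hpf))
    (mt (MulEquiv.isUnit_map swap).1 hp.not_isUnit)
  obtain ⟨h, hfh, hph⟩ := (FiniteMultiplicity.of_not_isUnit hp.not_isUnit
    hf.corr.isPrimitive.ne_zero).exists_eq_pow_mul_and_not_dvd
  filter_upwards [PolyCorr.eventually_exists_rootMultiplicity_eq hp hdeg hdeg' hph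
    (multiplicity p f)] with x ⟨y, hy, hm⟩
  rw [← hfh] at hm
  exact ⟨y, hy.dvd (Polynomial.map_dvd _ hpf), hm⟩

theorem IsMapOfTuples.multiplicity_eq (hf : IsMapOfTuples d f) {p q : ℂ[X][Y]}
    (hp : Irreducible p) (hq : Irreducible q) (hpf : p ∣ f) (hqf : q ∣ f) :
    multiplicity p f = multiplicity q f := by
  classical
  obtain ⟨x, ⟨y, hy, hm⟩, y', hy', hm'⟩ :=
    ((hf.eventually_exists_rootMultiplicity_eq hp hpf).and
      (hf.eventually_exists_rootMultiplicity_eq hq hqf)).exists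
  rw [← hm, ← hm', ← count_roots, ← count_roots, (hf.associated_map_swap hy hy').roots_eq]

theorem IsMapOfTuples.exists_squarefree_pow_eq (hd : d ≠ 0) (hf : IsMapOfTuples d f) :
    ∃ m ≠ 0, ∃ g, Squarefree g ∧ g ^ m = f := by
  have hunit : ¬ IsUnit f := fun h => hd (hf.corr.natDegree_eq ▸ natDegree_eq_zero_of_isUnit h)
  obtain ⟨p, hp, hpf⟩ := WfDvdMonoid.exists_irreducible_factor hunit hf.corr.isPrimitive.ne_zero
  exact ⟨multiplicity p f, multiplicity_ne_zero.2 hpf,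
    PolyCorr.exists_squarefree_pow_eq hf.corr.isPrimitive.ne_zero (multiplicity_ne_zero.2 hpf)
      fun q hq hqf => hf.multiplicity_eq hq hp hqf hpf⟩

theorem IsMapOfTuples.eventually_associated_pencil (hd : d ≠ 0) (hf : IsMapOfTuples d f)
    (hsq : Squarefree f) {i j : ℕ}
    (hab : LinearIndependent ℂ ![(swap f).coeff i, (swap f).coeff j]) :
    ∀ᶠ x in cofinite, ∃ y, Associated (f.map (evalRingHom x))
      (C (((swap f).coeff j).eval y) * (swap f).coeff i -
        C (((swap f).coeff i).eval y) * (swap f).coeff j) := by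
  filter_upwards [eventually_separable hsq hf.corr.isPrimitive,
    eventually_natDegree_map_eq hf.corr.isPrimitive.ne_zero,
    eventually_forall_isRoot_eval_ne_zero hf.corr.swap.isPrimitive (hab.ne_zero 0)]
    with x hsep hdeg hne
  obtain ⟨y, hy⟩ := IsAlgClosed.exists_root (f.map (evalRingHom x)) fun h0 =>
    hd (hf.corr.natDegree_eq ▸ hdeg ▸ natDegree_eq_of_degree_eq_some h0)
  refine ⟨y, associated_of_dvd_of_natDegree_le
    (dvd_of_separable_of_isRoot hsep fun y' hy' => ?_) (fun h0 => ?_) ?_⟩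
  · obtain ⟨c, -, hc⟩ := exists_eq_C_mul_of_associated (hf.associated_map_swap hy hy')
    have hcoeff (n : ℕ) : ((swap f).coeff n).eval y = c * ((swap f).coeff n).eval y' := by
      simpa only [coeff_map, coeff_C_mul, coe_evalRingHom] using congrArg (coeff · n) hc
    rw [IsRoot.def, eval_sub, eval_mul, eval_mul, eval_C, eval_C, hcoeff, hcoeff]
    ring
  · refine hne y hy (neg_eq_zero.1 (LinearIndependent.pair_iff.1 hab
      (((swap f).coeff j).eval y) (-((swap f).coeff i).eval y) ?_).2)
    rw [smul_eq_C_mul, smul_eq_C_mul, C_neg, neg_mul, ← sub_eq_add_neg, h0]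
  · have hcoeff := hf.corr.swap.natDegree_coeff_le
    rw [hdeg, hf.corr.natDegree_eq]
    exact (natDegree_sub_le _ _).trans (max_le ((natDegree_C_mul_le _ _).trans (hcoeff i))
      ((natDegree_C_mul_le _ _).trans (hcoeff j)))

theorem IsMapOfTuples.isSeparable_of_squarefree (hd : d ≠ 0) (hf : IsMapOfTuples d f)
    (hsq : Squarefree f) : IsSeparable d f := by
  have hs := hf.corr.swap
  obtain ⟨i, hi⟩ := exists_linearIndependent_coeff hs.isPrimitive
    (by rwa [swap_swap_apply, hf.corr.natDegree_eq])
  obtain ⟨P, Q, hP, hQ, hfPQ⟩ := exists_eq_crossDiff hi hs.natDegree_eq.le <| by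
    filter_upwards [hf.eventually_associated_pencil hd hsq hi] with x ⟨y, hxy⟩
    obtain ⟨c, -, hc⟩ := exists_eq_C_mul_of_associated hxy
    refine ⟨-c * ((swap f).leadingCoeff).eval y, -c * ((swap f).coeff i).eval y, ?_⟩
    rw [hc]
    simp only [leadingCoeff, C_mul, C_neg]
    ring
  rw [hfPQ]
  exact isSeparable_crossDiff hd hP hQ (hs.natDegree_coeff_le _) (hs.natDegree_coeff_le _)
    (hfPQ ▸ hf.corr)

end MapOfTuples

end PolyCorr

end

theorem theorem2p3_general {d : ℕ} (hd : 1 ≤ d) (f : Polynomial (Polynomial ℂ)) :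
    PolyCorr.IsMapOfTuples d f ↔ ∃ k, k ∣ d ∧ ∃ g : Polynomial (Polynomial ℂ),
      PolyCorr.IsCorrespondence k g ∧ PolyCorr.IsSeparable k g ∧ f = g ^ (d / k) := by
  constructor
  · intro hf
    obtain ⟨m, hm, g, hsq, rfl⟩ := hf.exists_squarefree_pow_eq (Nat.ne_of_gt hd)
    have hmd : d = m * g.natDegree := by rw [← Polynomial.natDegree_pow, hf.corr.natDegree_eq]
    obtain ⟨k, rfl⟩ : m ∣ d := ⟨_, hmd⟩
    have hk : k ≠ 0 := by rintro rfl; simp at hd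
    have hg : PolyCorr.IsMapOfTuples k g := (PolyCorr.isMapOfTuples_pow_iff hm).1 hf
    exact ⟨k, dvd_mul_left k m, g, hg.corr, hg.isSeparable_of_squarefree hk hsq,
      by rw [Nat.mul_div_cancel m (Nat.pos_of_ne_zero hk)]⟩
  · rintro ⟨k, ⟨m, rfl⟩, g, hg, hs, rfl⟩
    obtain ⟨hk, hm⟩ := mul_ne_zero_iff.1 (Nat.ne_of_gt hd)
    rw [Nat.mul_div_cancel_left m (Nat.pos_of_ne_zero hk), mul_comm]
    exact (PolyCorr.isMapOfTuples_pow_iff hm).2 (hs.isMapOfTuples hg)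

theorem theorem2p3 (d : ℕ) (hd : 1 ≤ d) (f : Polynomial (Polynomial ℂ))
    (hf : PolyCorr.IsCorrespondence d f)
    (hpow : ¬ ∃ k : ℕ, k ∣ d ∧ k ≠ d ∧
      ∃ g : Polynomial (Polynomial ℂ), PolyCorr.IsMapOfTuples k g ∧ f = g ^ (d / k)) :
    PolyCorr.IsMapOfTuples d f ↔ PolyCorr.IsSeparable d f := by
  refine ⟨fun h => ?_, fun h => h.isMapOfTuples hf⟩
  obtain ⟨k, hk, g, hg, hs, hfg⟩ := (theorem2p3_general hd f).1 h
  obtain rfl : k = d := by_contra fun hne => hpow ⟨k, hk, hne, g, hs.isMapOfTuples hg, hfg⟩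
  rwa [hfg, Nat.div_self hd, pow_one]
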